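/- **Spectral values of the axial evolution operator on a finite interval.** Units $c=G=1$, $k=4\pi$. Let a slowly, uniformly rotating relativistic star of radius $R>0$, angular velocity $\Omega$ and angular momentum $J$ be given by functions $\rho,p,M,\nu,\omega$ on $(0,\infty)$ with $2M(r)<r$ and, writing $\varpi=\Omega-\omega$, $e^{-\lambda}=1-2M/r$, $j=e^{-(\lambda+\nu)/2}$, $$M'=4\pi r^2\rho,\qquad p'=-\frac{(\rho+p)(M+4\pi r^3p)}{r(r-2M)},\qquad \nu'=\frac{2(M+4\pi r^3p)}{r(r-2M)},\qquad (r^4j\varpi')'=16\pi(\rho+p)e^{\lambda}jr^4\varpi .$$ Here $\rho$ is continuous on $(0,R]$ and may jump at $R$, where only the equation for $\nu$ is required; $M,p,\nu$ are continuous and $\omega$ is $C^1$ on $(0,\infty)$; $M(r)\to0$ and $\omega(r)$ has a finite limit as $r\to0$; for $r>R$, $\rho=0$; for $r\ge R$, $p=0$, $e^{\nu}=1-2M/r$ and $\omega=2J/r^3$. Let $l\ge2$ and $m$ be integers, $\Lambda=l(l+1)$. For $\vec h=(h_1,h_0,Z)$ define $D\vec h$ by $$-(D\vec h)_1=h_0'-Z,$$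 $$\begin{aligned}-(D\vec h)_2={}&\tfrac{e^{\nu}}{r^2}\left[2M+kr^3(p-\rho)\right]h_1+e^{\nu-\lambda}h_1'-\tfrac{im}{\Lambda}\left[\Lambda\omega-2e^{-\lambda}r\omega'-\varpi\left(2kr^2(\rho+p)+\tfrac{4M}{r}-\Lambda\right)\right]h_0\\&+\tfrac{im}{\Lambda}\varpi e^{-\lambda}r(rZ'-2h_0')-\tfrac{im}{\Lambda}\left[\omega'e^{-\lambda}r^2+\varpi\left(kr^3(\rho+p)-2re^{-\lambda}\right)\right]Z,\end{aligned}$$ $$\begin{aligned}-(D\vec h)_3={}&\tfrac{e^{\nu}}{r^3}\left[r(\Lambda-2)+4M+2kr^3(p-\rho)\right]h_1+\tfrac2re^{\nu-\lambda}h_1'+\tfrac{2im}{\Lambda}r\varpi e^{-\lambda}Z'+\tfrac{im}{\Lambda}(\Lambda\omega-4e^{-\lambda}\varpi)h_0'\\&+\tfrac{2im}{\Lambda}\left[(2e^{-\lambda}-kr^2(\rho+p))\varpi-\Lambda\omega-e^{-\lambda}r\omega'\right]Z\\&+\tfrac{2im}{\Lambda}\left[(1+2e^{-\lambda})\omega'+(2kr^3(\rho+p)-\Lambda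 r+4M)\tfrac{\varpi}{r^2}\right]h_0 .\end{aligned}$$ Let $0<a<b<\infty$ and $X=L^2_{\mathbb C}((a,b),j)\times L^2_{\mathbb C}((a,b),j)\times L^2_{\mathbb C}((a,b),r^2j)$. Let $A$ be the evolution operator on this interval with arbitrary (linear, homogeneous) boundary conditions: $A\vec h=D\vec h$ on a linear subspace $D(A)$ of $$\{\vec h\in (C^1\times C^2\times C^1)((a,b),\mathbb C)\cap X:\ D\vec h\in X\}$$ that contains all elements of this space with compact support in $(a,b)$. Then $A$ is closable, and for every $r\in[a,b]$ with $1-\frac{m^2}{\Lambda}\omega(r)\varpi(r)r^2e^{-\nu(r)}\neq0$ the number $$\sigma=\frac{im\left(\Omega-\frac{2}{\Lambda}\varpi(r)\right)}{1-\frac{m^2}{\Lambda}\omega(r)\varpi(r)r^2e^{-\nu(r)}}$$ belongs to the spectrum of the closure $\bar A$, i.e. $\bar A-\sigma:D(\bar A)\to X$ is not bijective. (The denominator is positive for all $r$ whenever the evolution equations have no complex characteristics.) -/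

import Mathlib

open MeasureTheory Set Filter Topology

noncomputable section

/-- A slowly and uniformly rotating relativistic star in geometrical units: the spherical
Tolman-Oppenheimer-Volkov background together with the first order frame dragging `ω`.
The density may jump at the surface `r = R`, so the equations whose right-hand side contains the
density are imposed for `r ≠ R`, together with continuity of the quantities differentiated. -/
structure RotatingStar where
  /-- radius of the star -/
  R : ℝ
  /-- angular velocity of the star -/
  Ω : ℝ
  /-- angular momentum of the star -/
  J : ℝ
  /-- energy density -/
  ρ : ℝ → ℝ
  /-- pressure -/
  p : ℝ → ℝ
  /-- mass inside radius `r` (constant outside the star) -/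
  M : ℝ → ℝ
  /-- metric potential, `g_tt = - exp ν` -/
  ν : ℝ → ℝ
  /-- angular velocity of the dragging of inertial frames -/
  ω : ℝ → ℝ
  R_pos : 0 < R
  two_M_lt : ∀ r, 0 < r → 2 * M r < r
  M_center : Tendsto M (𝓝[>] 0) (𝓝 0)
  ω_center : ∃ ω₀, Tendsto ω (𝓝[>] 0) (𝓝 ω₀)
  ρ_continuousOn : ContinuousOn ρ (Ioc 0 R)
  ρ_vacuum : ∀ r, R < r → ρ r = 0
  p_continuousOn : ContinuousOn p (Ioi 0)
  p_vacuum : ∀ r, R ≤ r → p r = 0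
  M_continuousOn : ContinuousOn M (Ioi 0)
  M_deriv : ∀ r, 0 < r → r ≠ R → HasDerivAt M (4 * Real.pi * r ^ 2 * ρ r) r
  p_deriv : ∀ r, 0 < r → r ≠ R →
    HasDerivAt p (-((ρ r + p r) * (M r + 4 * Real.pi * r ^ 3 * p r) / (r * (r - 2 * M r)))) r
  ν_deriv : ∀ r, 0 < r →
    HasDerivAt ν (2 * (M r + 4 * Real.pi * r ^ 3 * p r) / (r * (r - 2 * M r))) r
  ν_vacuum : ∀ r, R ≤ r → Real.exp (ν r) = 1 - 2 * M r / r
  ω_contDiffOn : ContDiffOn ℝ 1 ω (Ioi 0)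
  /-- With `ϖ = Ω - ω`, `e^{-λ} = 1 - 2 M / r` and `j = e^{-(λ+ν)/2}`:
  `(r⁴ j ϖ')' = 16 π (ρ + p) e^λ j r⁴ ϖ`. -/
  ω_equation : ∀ r, 0 < r → r ≠ R →
    HasDerivAt
      (fun s => s ^ 4 * (Real.sqrt (1 - 2 * M s / s) * Real.exp (-ν s / 2)) *
        deriv (fun t => Ω - ω t) s)
      (16 * Real.pi * (ρ r + p r) * (1 - 2 * M r / r)⁻¹ *
        (Real.sqrt (1 - 2 * M r / r) * Real.exp (-ν r / 2)) * r ^ 4 * (Ω - ω r)) r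
  ω_vacuum : ∀ r, R ≤ r → ω r = 2 * J / r ^ 3

namespace RotatingStar

variable (S : RotatingStar)

/-- `ϖ = Ω - ω`. -/
def varpi (r : ℝ) : ℝ := S.Ω - S.ω r

/-- `λ`, defined by `e^{-λ} = 1 - 2 M / r`. -/
def lam (r : ℝ) : ℝ := -Real.log (1 - 2 * S.M r / r)

/-- `j = e^{-(λ + ν)/2}`. -/
def j (r : ℝ) : ℝ := Real.exp (-(S.lam r + S.ν r) / 2)

/-- The three measures `j dr`, `j dr`, `r² j dr` on the interval from `a` to `b`. -/
def mu (a b : ℝ) (i : Fin 3) : Measure ℝ :=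
  (volume.restrict (Ioo a b)).withDensity
    fun r => ENNReal.ofReal ((![S.j r, S.j r, r ^ 2 * S.j r] : Fin 3 → ℝ) i)

/-- The Hilbert space `L²((a,b), j) × L²((a,b), j) × L²((a,b), r² j)`. -/
abbrev X (a b : ℝ) : Type := PiLp 2 fun i : Fin 3 => Lp ℂ 2 (S.mu a b i)

/-- The differential expression `D` of the evolution equations `dh/dt = - D h` for axial
perturbations `h = (h₁, h₀, Z)` with angular numbers `l`, `m`; here `Λ = l (l + 1)`, `k = 4 π`. -/
def evolD (l : ℕ) (m : ℤ) (h : Fin 3 → ℝ → ℂ) : Fin 3 → ℝ → ℂ := fun i r =>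
  let h₁ : ℝ → ℂ := h 0
  let h₀ : ℝ → ℂ := h 1
  let Z : ℝ → ℂ := h 2
  let Λ : ℝ := l * (l + 1)
  let k : ℝ := 4 * Real.pi
  let imΛ : ℂ := Complex.I * m / (Λ : ℂ)
  let M : ℝ := S.M r
  let ρ : ℝ := S.ρ r
  let p : ℝ := S.p r
  let eν : ℝ := Real.exp (S.ν r)
  let eνl : ℝ := Real.exp (S.ν r - S.lam r)
  let el : ℝ := Real.exp (-S.lam r)
  let ω : ℝ := S.ω r
  let ω' : ℝ := deriv S.ω r
  let ϖ : ℝ := S.varpi r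
  (![-(deriv h₀ r - Z r),
     -(((eν / r ^ 2 * (2 * M + k * r ^ 3 * (p - ρ)) : ℝ) : ℂ) * h₁ r
        + (eνl : ℂ) * deriv h₁ r
        - imΛ * ((Λ * ω - 2 * el * r * ω'
            - ϖ * (2 * k * r ^ 2 * (ρ + p) + 4 * M / r - Λ) : ℝ) : ℂ) * h₀ r
        + imΛ * ((ϖ * el * r : ℝ) : ℂ) * ((r : ℂ) * deriv Z r - 2 * deriv h₀ r)
        - imΛ * ((ω' * el * r ^ 2 + ϖ * (k * r ^ 3 * (ρ + p) - 2 * r * el) : ℝ) : ℂ) * Z r),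
     -(((eν / r ^ 3 * (r * (Λ - 2) + 4 * M + 2 * k * r ^ 3 * (p - ρ)) : ℝ) : ℂ) * h₁ r
        + ((2 / r * eνl : ℝ) : ℂ) * deriv h₁ r
        + 2 * imΛ * ((r * ϖ * el : ℝ) : ℂ) * deriv Z r
        + imΛ * ((Λ * ω - 4 * el * ϖ : ℝ) : ℂ) * deriv h₀ r
        + 2 * imΛ * (((2 * el - k * r ^ 2 * (ρ + p)) * ϖ - Λ * ω - el * r * ω' : ℝ) : ℂ) * Z r
        + 2 * imΛ * (((1 + 2 * el) * ω'
            + (2 * k * r ^ 3 * (ρ + p) - Λ * r + 4 * M) * (ϖ / r ^ 2) : ℝ) : ℂ) * h₀ r)]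
    : Fin 3 → ℂ) i

/-- `h` is of class `C¹ × C² × C¹` on the open interval. -/
def IsRegular (a b : ℝ) (h : Fin 3 → ℝ → ℂ) : Prop :=
  ContDiffOn ℝ 1 (h 0) (Ioo a b) ∧ ContDiffOn ℝ 2 (h 1) (Ioo a b) ∧
    ContDiffOn ℝ 1 (h 2) (Ioo a b)

/-- The element `u` of the Hilbert space is represented by the functions `h`. -/
def Represents (a b : ℝ) (h : Fin 3 → ℝ → ℂ) (u : S.X a b) : Prop :=
  ∀ i, (u i : ℝ → ℂ) =ᵐ[S.mu a b i] h i

/-- `A` is the evolution operator on the interval from `a` to `b` with some (linear homogeneous)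
boundary conditions: `A` is linear, every element of its domain is (represented by) some
`h` in `C¹ × C² × C¹` with `h` and `D h` in the Hilbert space, `A h = D h`, and the domain contains
all such `h` that vanish near both end points (for these every boundary condition is satisfied). -/
structure IsEvolutionOperator (l : ℕ) (m : ℤ) (a b : ℝ) (A : S.X a b →ₗ.[ℂ] S.X a b) : Prop where
  classical : ∀ u v, (u, v) ∈ A.graph →
    ∃ h, IsRegular a b h ∧ S.Represents a b h u ∧ S.Represents a b (S.evolD l m h) v
  contains : ∀ h u v, IsRegular a b h →
    (∀ i, HasCompactSupport (h i) ∧ tsupport (h i) ⊆ Ioo a b) →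
    S.Represents a b h u → S.Represents a b (S.evolD l m h) v → (u, v) ∈ A.graph

/-- The denominator `1 - (m²/Λ) ω ϖ r² e^{-ν}`. -/
def kojimaDenom (l : ℕ) (m : ℤ) (r : ℝ) : ℝ :=
  1 - (m : ℝ) ^ 2 / (l * (l + 1)) * S.ω r * S.varpi r * r ^ 2 * Real.exp (-S.ν r)

/-- The value `i m (Ω - 2 ϖ / Λ) / (1 - (m²/Λ) ω ϖ r² e^{-ν})`. -/
def kojimaValue (l : ℕ) (m : ℤ) (r : ℝ) : ℂ :=
  Complex.I * m * ((S.Ω - 2 / (l * (l + 1)) * S.varpi r : ℝ) : ℂ) / (S.kojimaDenom l m r : ℂ)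

end RotatingStar

/-- The spectrum of a (closed, in general unbounded) operator `B` in `E`: all complex `σ` such that
`B - σ : D(B) → E` is not bijective. -/
def opSpectrum {E : Type*} [AddCommGroup E] [Module ℂ E] (B : E →ₗ.[ℂ] E) : Set ℂ :=
  {σ | ¬ Function.Bijective fun x : B.domain => B x - σ • (x : E)}

end

/-!
Write `h = (h₁, h₀, Z)` and `v = D h`, and let `α = (i m / Λ) ϖ e^{-ν} r²`. Three consequences of
the evolution equations carry the proof; they are collected in `WeakEvolution`.

* `h₀' = Z - v₀`.
* After division by `e^{ν - λ}`, the second component expresses `(h₁ + α Z)'` through `h` and `v`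
  with bounded coefficients. The function `α` is continuously differentiable even at the surface of
  the star, since `ν'` does not involve the density.
* In `(2/r) v₁ - v₂` all derivatives except `h₀'` cancel, so `v` and `h` satisfy a linear relation
  almost everywhere.

Written with primitives, these equations survive mean-square limits, so they hold on the closure
of the graph of every realization of `D`, whatever the boundary conditions
(`IsEvolutionOperator.weakEvolution_of_mem_closure`).

For `h = 0` they give `v = 0` one component at a time; hence the operator is closable.

For the spectrum, suppose `(D - σ) h = (0, 0, f)` in the weak sense. Eliminating `h₁` from the
algebraic relation in favour of `h₁ + α Z` turns it into
`f = g Z + c₀ h₀ - c₁ (h₁ + α Z)` with bounded `c₀`, `c₁` and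
`g = i m (Ω - 2 ϖ / Λ) - σ (1 - (m² / Λ) ω ϖ r² e^{-ν})`. Primitives of integrable functions are
bounded, so `|f| ≤ |g| |Z| + C`. If `g` vanishes at `r₀`, which happens when `σ` is the value in
question at `r₀`, then `g = O(r - r₀)`, and for the square integrable function
`f = |r - r₀|^(-1/4)` the estimate makes `|Z|` at least `1 / |r - r₀|` near `r₀`. As this is not
integrable, `f` is not attained: the closure minus `σ` is not surjective.
-/

open scoped ENNReal

/-! ### Primitives and mean-square limits -/

/-- `f` agrees almost everywhere on `(a, b)` with a primitive of `g`; for integrable `g` this says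
that `f` is, up to a null set, absolutely continuous with weak derivative `g`. -/
def IsPrimitive (a b : ℝ) (f g : ℝ → ℂ) : Prop :=
  ∃ c : ℂ, ∀ᵐ x ∂(volume.restrict (Ioo a b)), f x = c + ∫ t in a..x, g t

/-- Mean-square convergence of square integrable functions (rather than of classes in `Lp`). -/
structure TendstoL2 (μ : Measure ℝ) (F : ℕ → ℝ → ℂ) (f : ℝ → ℂ) : Prop where
  memLp : ∀ n, MemLp (F n) 2 μ
  memLp_lim : MemLp f 2 μ
  tendsto : Tendsto (fun n => eLpNorm (F n - f) 2 μ) atTop (𝓝 0)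

namespace TendstoL2

variable {μ : Measure ℝ} {F G : ℕ → ℝ → ℂ} {f g : ℝ → ℂ}

lemma const (hf : MemLp f 2 μ) : TendstoL2 μ (fun _ => f) f :=
  ⟨fun _ => hf, hf, by simp⟩

lemma add (hF : TendstoL2 μ F f) (hG : TendstoL2 μ G g) :
    TendstoL2 μ (fun n x => F n x + G n x) (fun x => f x + g x) where
  memLp n := (hF.memLp n).add (hG.memLp n)
  memLp_lim := hF.memLp_lim.add hG.memLp_lim
  tendsto := by
    have h := hF.tendsto.add hG.tendsto
    rw [add_zero] at h
    refine tendsto_of_tendsto_of_tendsto_of_le_of_le tendsto_const_nhds h (fun _ => zero_le) ?_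
    intro n
    have : (fun x => F n x + G n x) - (fun x => f x + g x) = (F n - f) + (G n - g) := by
      ext x; simp only [Pi.sub_apply, Pi.add_apply]; ring
    dsimp only
    rw [this]
    exact eLpNorm_add_le ((hF.memLp n).sub hF.memLp_lim).1 ((hG.memLp n).sub hG.memLp_lim).1
      (by norm_num)

lemma mul_left {c : ℝ → ℂ} (hc : MemLp c ∞ μ) (hF : TendstoL2 μ F f) :
    TendstoL2 μ (fun n x => c x * F n x) (fun x => c x * f x) where
  memLp n := (hF.memLp n).mul' hc
  memLp_lim := hF.memLp_lim.mul' hc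
  tendsto := by
    have h := ENNReal.Tendsto.const_mul hF.tendsto (Or.inr hc.2.ne)
    rw [mul_zero] at h
    refine tendsto_of_tendsto_of_tendsto_of_le_of_le tendsto_const_nhds h (fun _ => zero_le) ?_
    intro n
    have : (fun x => c x * F n x) - (fun x => c x * f x) = c • (F n - f) := by
      ext x; simp only [Pi.sub_apply, Pi.smul_apply', smul_eq_mul]; ring
    dsimp only
    rw [this]
    exact eLpNorm_smul_le_mul_eLpNorm ((hF.memLp n).sub hF.memLp_lim).1 hc.1

lemma neg (hF : TendstoL2 μ F f) : TendstoL2 μ (fun n x => -F n x) (fun x => -f x) where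
  memLp _ := (hF.memLp _).neg
  memLp_lim := hF.memLp_lim.neg
  tendsto := by
    refine hF.tendsto.congr fun n => ?_
    rw [← eLpNorm_neg]
    congr 1
    ext x; simp only [Pi.sub_apply, Pi.neg_apply]; ring

lemma sub (hF : TendstoL2 μ F f) (hG : TendstoL2 μ G g) :
    TendstoL2 μ (fun n x => F n x - G n x) (fun x => f x - g x) := by
  simpa only [sub_eq_add_neg] using hF.add hG.neg

lemma comp (hF : TendstoL2 μ F f) {φ : ℕ → ℕ} (hφ : StrictMono φ) :
    TendstoL2 μ (fun n => F (φ n)) f :=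
  ⟨fun _ => hF.memLp _, hF.memLp_lim, hF.tendsto.comp hφ.tendsto_atTop⟩

lemma exists_ae_tendsto (hF : TendstoL2 μ F f) :
    ∃ φ : ℕ → ℕ, StrictMono φ ∧ ∀ᵐ x ∂μ, Tendsto (fun n => F (φ n) x) atTop (𝓝 (f x)) :=
  (tendstoInMeasure_of_tendsto_eLpNorm (by norm_num) (fun n => (hF.memLp n).1) hF.memLp_lim.1
    hF.tendsto).exists_seq_tendsto_ae

lemma ae_eq_zero_of_forall (hF : TendstoL2 μ F f) (h : ∀ n, F n =ᵐ[μ] 0) : f =ᵐ[μ] 0 := by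
  obtain ⟨φ, -, hφ⟩ := hF.exists_ae_tendsto
  filter_upwards [hφ, ae_all_iff.2 h] with x hx h0
  refine tendsto_nhds_unique hx ?_
  simp only [h0, Pi.zero_apply, tendsto_const_nhds]

lemma tendsto_integral [IsFiniteMeasure μ] (hF : TendstoL2 μ F f) (s : Set ℝ) :
    Tendsto (fun n => ∫ x in s, F n x ∂μ) atTop (𝓝 (∫ x in s, f x ∂μ)) := by
  refine tendsto_setIntegral_of_L1' f hF.memLp_lim.1
    (Eventually.of_forall fun n => (hF.memLp n).integrable (by norm_num)) ?_ s
  have h := ENNReal.Tendsto.mul_const hF.tendsto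
    (b := μ Set.univ ^ (1 / (1 : ℝ≥0∞).toReal - 1 / (2 : ℝ≥0∞).toReal))
    (Or.inr (ENNReal.rpow_ne_top_of_nonneg (by norm_num) (measure_ne_top _ _)))
  rw [zero_mul] at h
  exact tendsto_of_tendsto_of_tendsto_of_le_of_le tendsto_const_nhds h (fun _ => zero_le)
    fun n => eLpNorm_le_eLpNorm_mul_rpow_measure_univ (by norm_num)
      ((hF.memLp n).sub hF.memLp_lim).1

end TendstoL2

namespace IsPrimitive

variable {a b : ℝ} {f f' g g' : ℝ → ℂ}

lemma congr (h : IsPrimitive a b f g) (hf : f =ᵐ[volume.restrict (Ioo a b)] f')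
    (hg : g =ᵐ[volume.restrict (Ioo a b)] g') : IsPrimitive a b f' g' := by
  obtain ⟨c, hc⟩ := h
  refine ⟨c, ?_⟩
  filter_upwards [hc, hf, ae_restrict_mem measurableSet_Ioo] with x hx hfx hxm
  rw [← hfx, hx]
  congr 1
  refine intervalIntegral.integral_congr_ae ?_
  rw [EventuallyEq, ae_restrict_iff' measurableSet_Ioo] at hg
  filter_upwards [hg] with t ht hta
  rw [uIoc_of_le hxm.1.le] at hta
  exact ht ⟨hta.1, hta.2.trans_lt hxm.2⟩

lemma intervalIntegrable_of_mem (hg : IntegrableOn g (Ioo a b)) {x y : ℝ} (hx : x ∈ Icc a b)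
    (hy : y ∈ Icc a b) : IntervalIntegrable g volume x y := by
  rw [intervalIntegrable_iff]
  refine IntegrableOn.mono_set ((integrableOn_Icc_iff_integrableOn_Ioo (μ := volume)).2 hg) ?_
  exact uIoc_subset_uIcc.trans (uIcc_subset_Icc hx hy)

lemma of_hasDerivAt (hab : a < b) (hf : ∀ x ∈ Ioo a b, HasDerivAt f (g x) x)
    (hg : IntegrableOn g (Ioo a b)) : IsPrimitive a b f g := by
  obtain ⟨x₀, hx₀⟩ := nonempty_Ioo.2 hab
  refine ⟨f x₀ - ∫ t in a..x₀, g t, ?_⟩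
  filter_upwards [ae_restrict_mem measurableSet_Ioo] with x hx
  have h := intervalIntegral.integral_eq_sub_of_hasDerivAt (a := x₀) (b := x)
    (fun t ht => hf t ((ordConnected_Ioo (a := a) (b := b)).uIcc_subset hx₀ hx ht))
    (intervalIntegrable_of_mem hg (Ioo_subset_Icc_self hx₀) (Ioo_subset_Icc_self hx))
  have h2 := intervalIntegral.integral_add_adjacent_intervals
    (intervalIntegrable_of_mem hg (left_mem_Icc.2 hab.le) (Ioo_subset_Icc_self hx₀))
    (intervalIntegrable_of_mem hg (Ioo_subset_Icc_self hx₀) (Ioo_subset_Icc_self hx))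
  rw [← h2, h]
  ring

lemma exists_bound (h : IsPrimitive a b f g) (hg : IntegrableOn g (Ioo a b)) :
    ∃ C, ∀ᵐ x ∂(volume.restrict (Ioo a b)), ‖f x‖ ≤ C := by
  obtain ⟨c, hc⟩ := h
  refine ⟨‖c‖ + ∫ t in Ioo a b, ‖g t‖, ?_⟩
  filter_upwards [hc, ae_restrict_mem measurableSet_Ioo] with x hx hxm
  rw [hx]
  refine (norm_add_le _ _).trans (add_le_add_right ?_ _)
  refine intervalIntegral.norm_integral_le_integral_norm_uIoc.trans ?_
  refine setIntegral_mono_set hg.norm (Eventually.of_forall fun _ => norm_nonneg _) ?_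
  rw [uIoc_of_le hxm.1.le]
  exact (Ioc_subset_Ioo_right hxm.2).eventuallyLE

lemma ae_eq_zero (hab : a < b) (h : IsPrimitive a b f g) (hf : f =ᵐ[volume.restrict (Ioo a b)] 0)
    (hg : IntegrableOn g (Ioo a b)) : g =ᵐ[volume.restrict (Ioo a b)] 0 := by
  obtain ⟨c, hc⟩ := h
  have hga := intervalIntegrable_of_mem hg (left_mem_Icc.2 hab.le) (right_mem_Icc.2 hab.le)
  have hcont : ContinuousOn (fun x => c + ∫ t in a..x, g t) (Ioo a b) := by
    refine continuousOn_const.add ?_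
    refine (intervalIntegral.continuousOn_primitive_interval ?_).mono
      (Ioo_subset_Icc_self.trans Icc_subset_uIcc)
    rw [uIcc_of_le hab.le]
    exact (integrableOn_Icc_iff_integrableOn_Ioo (μ := volume)).2 hg
  have heq : EqOn (fun x => c + ∫ t in a..x, g t) (fun _ => (0 : ℂ)) (Ioo a b) := by
    refine Measure.eqOn_open_of_ae_eq (μ := volume) ?_ isOpen_Ioo hcont continuousOn_const
    filter_upwards [hc, hf] with x hx hfx
    rw [← hx, hfx]
    rfl
  rw [EventuallyEq, ae_restrict_iff' measurableSet_Ioo]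
  filter_upwards [hga.ae_hasDerivAt_integral] with x hx hxm
  have h1 := (hx (Icc_subset_uIcc (Ioo_subset_Icc_self hxm)) a left_mem_uIcc).const_add c
  have h2 : HasDerivAt (fun x => c + ∫ t in a..x, g t) 0 x :=
    (hasDerivAt_const x (0 : ℂ)).congr_of_eventuallyEq
      (heq.eventuallyEq_of_mem (isOpen_Ioo.mem_nhds hxm))
  exact h1.unique h2

/-- Being a primitive survives mean-square limits: this is what turns the classical domain of a
differential operator into information about the domain of its closure. -/
lemma of_tendstoL2 (hab : a < b) {F G : ℕ → ℝ → ℂ} (h : ∀ n, IsPrimitive a b (F n) (G n))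
    (hF : TendstoL2 (volume.restrict (Ioo a b)) F f)
    (hG : TendstoL2 (volume.restrict (Ioo a b)) G g) : IsPrimitive a b f g := by
  obtain ⟨φ, hφ, hlim⟩ := hF.exists_ae_tendsto
  choose c hc using h
  have hint : ∀ x ∈ Ioo a b,
      Tendsto (fun n => ∫ t in a..x, G (φ n) t) atTop (𝓝 (∫ t in a..x, g t)) := by
    intro x hx
    have := (hG.comp hφ).tendsto_integral (Ioc a x)
    rw [Measure.restrict_restrict_of_subset (Ioc_subset_Ioo_right hx.2)] at this
    simpa only [intervalIntegral.integral_of_le hx.1.le] using this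
  have hall : ∀ᵐ x ∂(volume.restrict (Ioo a b)), x ∈ Ioo a b ∧
      Tendsto (fun n => F (φ n) x) atTop (𝓝 (f x)) ∧
      ∀ n, F n x = c n + ∫ t in a..x, G n t := by
    filter_upwards [hlim, ae_all_iff.2 hc, ae_restrict_mem measurableSet_Ioo] with x h1 h2 h3
    exact ⟨h3, h1, h2⟩
  have hne : NeBot (ae (volume.restrict (Ioo a b))) := by
    rw [ae_neBot, Ne, Measure.restrict_eq_zero, Real.volume_Ioo, ENNReal.ofReal_eq_zero]
    linarith
  -- a single good point already forces the constants of integration to converge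
  obtain ⟨x₀, hx₀, hl₀, he₀⟩ := hall.exists
  have hcl : Tendsto (fun n => c (φ n)) atTop (𝓝 (f x₀ - ∫ t in a..x₀, g t)) := by
    refine (hl₀.sub (hint x₀ hx₀)).congr fun n => ?_
    rw [he₀]; ring
  refine ⟨f x₀ - ∫ t in a..x₀, g t, ?_⟩
  filter_upwards [hall] with x ⟨hx, hl, he⟩
  refine tendsto_nhds_unique hl ((hcl.add (hint x hx)).congr fun n => ?_)
  rw [he]

end IsPrimitive

/-! ### An unattainable right-hand side -/

/-- An unbounded but square integrable function: `|x - r|^(-1/4)`. -/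
lemma memLp_two_abs_sub_rpow (a b r : ℝ) :
    MemLp (fun x : ℝ => ((|x - r| ^ (-(1 / 4) : ℝ) : ℝ) : ℂ)) 2 (volume.restrict (Ioo a b)) := by
  have hm : Measurable fun x : ℝ => ((|x - r| ^ (-(1 / 4) : ℝ) : ℝ) : ℂ) := by fun_prop
  rw [memLp_two_iff_integrable_sq_norm hm.aestronglyMeasurable]
  have hpos : ∀ c : ℝ, 0 ≤ c →
      IntervalIntegrable (fun x : ℝ => |x| ^ (-(1 / 2) : ℝ)) volume 0 c := by
    intro c hc
    refine (intervalIntegral.intervalIntegrable_rpow' (r := -(1 / 2)) (by norm_num)).congr ?_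
    intro x hx
    rw [uIoc_of_le hc] at hx
    simp only [abs_of_pos hx.1]
  have hall : ∀ c : ℝ, IntervalIntegrable (fun x : ℝ => |x| ^ (-(1 / 2) : ℝ)) volume 0 c := by
    intro c
    rcases le_total 0 c with hc | hc
    · exact hpos c hc
    · have := (IntervalIntegrable.iff_comp_neg (f := fun x : ℝ => |x| ^ (-(1 / 2) : ℝ))
        (a := 0) (b := c)).2
      simp only [abs_neg, neg_zero] at this
      exact this (hpos _ (by linarith))
  have h : IntervalIntegrable (fun x : ℝ => |x - r| ^ (-(1 / 2) : ℝ)) volume a b := by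
    have := ((hall (a - r)).symm.trans (hall (b - r))).comp_sub_right r
    simpa using this
  have h2 : IntegrableOn (fun x : ℝ => |x - r| ^ (-(1 / 2) : ℝ)) (Ioo a b) :=
    (h.def'.mono_set (Ioo_subset_Ioc_self.trans Ioc_subset_uIoc))
  refine h2.congr (Eventually.of_forall fun x => ?_)
  dsimp only
  rw [Complex.norm_real, Real.norm_of_nonneg (by positivity), ← Real.rpow_natCast,
    ← Real.rpow_mul (abs_nonneg _)]
  norm_num

/-- If `g` vanishes at `r` to first order, then `|x - r|^(-1/4)` is not the sum of a bounded
function and an integrable multiple of `g`. -/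
lemma not_ae_abs_sub_rpow_le {a b r : ℝ} (hab : a < b) (hr : r ∈ Icc a b) {g Z : ℝ → ℂ}
    (hg : g =O[𝓝 r] fun x => x - r) (hZ : IntegrableOn Z (Ioo a b)) (C : ℝ) :
    ¬ ∀ᵐ x ∂(volume.restrict (Ioo a b)),
      |x - r| ^ (-(1 / 4) : ℝ) ≤ ‖g x‖ * ‖Z x‖ + C := by
  intro hC
  obtain ⟨L, hL, hgL⟩ := hg.exists_pos
  rw [Asymptotics.IsBigOWith_def] at hgL
  have hbig : ∀ᶠ x in 𝓝[≠] r, C + L ≤ |x - r| ^ (-(1 / 4) : ℝ) := by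
    have h0 : Tendsto (fun x : ℝ => |x - r|) (𝓝[≠] r) (𝓝[>] 0) := by
      refine tendsto_nhdsWithin_iff.2 ⟨?_, ?_⟩
      · have : Continuous fun x : ℝ => |x - r| := by fun_prop
        simpa using (this.tendsto r).mono_left nhdsWithin_le_nhds
      · filter_upwards [self_mem_nhdsWithin] with x hx
        exact abs_pos.2 (sub_ne_zero.2 hx)
    exact ((tendsto_rpow_neg_nhdsGT_zero (by norm_num)).comp h0).eventually_ge_atTop _
  have hev : ∀ᶠ x in 𝓝 r, ‖g x‖ ≤ L * |x - r| ∧ (x ≠ r → C + L ≤ |x - r| ^ (-(1 / 4) : ℝ)) := by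
    filter_upwards [hgL, eventually_nhdsWithin_iff.1 hbig] with x h1 h2
    exact ⟨h1, h2⟩
  obtain ⟨δ, hδ, hball⟩ := Metric.eventually_nhds_iff.1 hev
  -- a subinterval of `(a, b)` within `δ` of `r` that has `r` as an end point
  obtain ⟨s, t, hst, hs, ht, hsub, hrst⟩ : ∃ s t, s < t ∧ r - δ ≤ s ∧ t ≤ r + δ ∧
      Ioo s t ⊆ Ioo a b ∧ r ∈ Icc s t := by
    rcases hr.2.lt_or_eq with hrb | hrb
    · exact ⟨r, min (r + δ) b, lt_min (by linarith) hrb, by linarith, min_le_left _ _,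
        Ioo_subset_Ioo hr.1 (min_le_right _ _), le_rfl, le_min (by linarith) hrb.le⟩
    · exact ⟨max (r - δ) a, r, max_lt (by linarith) (hrb ▸ hab), le_max_left _ _, by linarith,
        Ioo_subset_Ioo (le_max_right _ _) hrb.le, max_le (by linarith) hr.1, le_rfl⟩
  have hle : ∀ᵐ x ∂(volume.restrict (Ioo s t)), ‖(x - r)⁻¹‖ ≤ ‖Z x‖ := by
    filter_upwards [ae_restrict_of_ae_restrict_of_subset hsub hC,
      ae_restrict_mem measurableSet_Ioo] with x hx hxm
    by_cases hxr : x = r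
    · simp [hxr]
    obtain ⟨h1, h2⟩ := hball (y := x) (by
      rw [Real.dist_eq, abs_lt]; constructor <;> linarith [hxm.1, hxm.2])
    have hpos : 0 < |x - r| := abs_pos.2 (sub_ne_zero.2 hxr)
    have h3 : L ≤ L * |x - r| * ‖Z x‖ := by
      have := mul_le_mul_of_nonneg_right h1 (norm_nonneg (Z x))
      linarith [h2 hxr]
    rw [norm_inv, Real.norm_eq_abs, inv_le_iff_one_le_mul₀' hpos]
    refine le_of_mul_le_mul_left ?_ hL
    linarith
  have hint : IntegrableOn (fun x => (x - r)⁻¹) (Ioo s t) :=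
    Integrable.mono (hZ.mono_set hsub) (by fun_prop) hle
  have hii : IntervalIntegrable (fun x => (x - r)⁻¹) volume s t := by
    rwa [intervalIntegrable_iff_integrableOn_Ioo_of_le hst.le]
  rcases intervalIntegrable_sub_inv_iff.1 hii with h | h
  · exact hst.ne h
  · exact h (Icc_subset_uIcc hrst)

/-! ### The coefficients on a compact interval -/

lemma memLp_top_of_continuousOn {E : Type*} [NormedAddCommGroup E] {a b : ℝ} (ha : 0 < a)
    {c : ℝ → E} (hc : ContinuousOn c (Ioi 0)) : MemLp c ∞ (volume.restrict (Ioo a b)) := by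
  have hc' : ContinuousOn c (Icc a b) := hc.mono fun x hx => ha.trans_le hx.1
  obtain ⟨C, hC⟩ := isCompact_Icc.exists_bound_of_continuousOn hc'
  refine memLp_top_of_bound
    ((hc'.mono Ioo_subset_Icc_self).aestronglyMeasurable measurableSet_Ioo) C ?_
  filter_upwards [ae_restrict_mem measurableSet_Ioo] with x hx
  exact hC x (Ioo_subset_Icc_self hx)

lemma ContinuousOn.complex_ofReal {f : ℝ → ℝ} {s : Set ℝ} (hf : ContinuousOn f s) :
    ContinuousOn (fun r => (f r : ℂ)) s :=
  Complex.continuous_ofReal.comp_continuousOn hf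

namespace RotatingStar

variable (S : RotatingStar)

lemma one_sub_pos {r : ℝ} (hr : 0 < r) : 0 < 1 - 2 * S.M r / r := by
  rw [sub_pos, div_lt_one hr]
  exact S.two_M_lt r hr

lemma continuousOn_lam : ContinuousOn S.lam (Ioi 0) := by
  have hM := S.M_continuousOn
  refine (ContinuousOn.log ?_ fun r hr => (S.one_sub_pos hr).ne').neg
  exact continuousOn_const.sub ((continuousOn_const.mul hM).div continuousOn_id
    fun r hr => (ne_of_gt hr))

lemma continuousOn_nu : ContinuousOn S.ν (Ioi 0) :=
  fun r hr => (S.ν_deriv r hr).continuousAt.continuousWithinAt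

lemma continuousOn_j : ContinuousOn S.j (Ioi 0) := by
  have h1 := S.continuousOn_lam
  have h2 := S.continuousOn_nu
  unfold j
  fun_prop

lemma continuousOn_omega : ContinuousOn S.ω (Ioi 0) := S.ω_contDiffOn.continuousOn

lemma continuousOn_deriv_omega : ContinuousOn (deriv S.ω) (Ioi 0) :=
  S.ω_contDiffOn.continuousOn_deriv_of_isOpen isOpen_Ioi le_rfl

lemma continuousOn_varpi : ContinuousOn S.varpi (Ioi 0) :=
  continuousOn_const.sub S.continuousOn_omega

/-- The potential `ν` is continuously differentiable even across the surface, since its derivative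
involves the pressure but not the density. -/
lemma contDiffOn_nu : ContDiffOn ℝ 1 S.ν (Ioi 0) := by
  rw [show (1 : WithTop ℕ∞) = 0 + 1 from (zero_add 1).symm,
    contDiffOn_succ_iff_deriv_of_isOpen isOpen_Ioi]
  refine ⟨fun r hr => (S.ν_deriv r hr).differentiableAt.differentiableWithinAt, by simp, ?_⟩
  rw [contDiffOn_zero]
  have hM := S.M_continuousOn
  have hp := S.p_continuousOn
  have : ContinuousOn (fun r => 2 * (S.M r + 4 * Real.pi * r ^ 3 * S.p r) / (r * (r - 2 * S.M r)))
      (Ioi 0) := by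
    refine ContinuousOn.div (by fun_prop) (by fun_prop) fun r hr => ?_
    exact (mul_pos hr (sub_pos.2 (S.two_M_lt r hr))).ne'
  exact this.congr fun r hr => (S.ν_deriv r hr).deriv

/-- The coefficient `(i m / Λ) ϖ e^{-ν} r²` of `Z'` in the second component of `-D`, relative to
the coefficient `e^{ν - λ}` of `h₁'`. -/
noncomputable def alpha (l : ℕ) (m : ℤ) (r : ℝ) : ℂ :=
  Complex.I * m / (((l * (l + 1) : ℝ)) : ℂ) *
    ((S.varpi r * Real.exp (-S.ν r) * r ^ 2 : ℝ) : ℂ)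

lemma contDiffOn_alpha (l : ℕ) (m : ℤ) : ContDiffOn ℝ 1 (S.alpha l m) (Ioi 0) := by
  have h1 : ContDiffOn ℝ 1 S.varpi (Ioi 0) := contDiffOn_const.sub S.ω_contDiffOn
  have h2 := S.contDiffOn_nu
  refine contDiffOn_const.mul (Complex.ofRealCLM.contDiff.comp_contDiffOn ?_)
  exact (h1.mul h2.neg.exp).mul (contDiffOn_id.pow 2)

lemma hasDerivAt_alpha (l : ℕ) (m : ℤ) {r : ℝ} (hr : 0 < r) :
    HasDerivAt (S.alpha l m) (deriv (S.alpha l m) r) r :=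
  (((S.contDiffOn_alpha l m).contDiffAt (Ioi_mem_nhds hr)).differentiableAt one_ne_zero).hasDerivAt

lemma memLp_top_rho {a b : ℝ} (ha : 0 < a) :
    MemLp S.ρ ∞ (volume.restrict (Ioo a b)) := by
  obtain ⟨C, hC⟩ := isCompact_Icc.exists_bound_of_continuousOn
    (S.ρ_continuousOn.mono (show Icc a S.R ⊆ Ioc 0 S.R from fun x hx => ⟨ha.trans_le hx.1, hx.2⟩))
  have hmeas : Measurable ((Ioc 0 S.R).indicator S.ρ) := by
    rw [← piecewise_eq_indicator]
    exact S.ρ_continuousOn.measurable_piecewise continuousOn_const measurableSet_Ioc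
  have heq : ∀ r ∈ Ioo a b, (Ioc 0 S.R).indicator S.ρ r = S.ρ r := by
    intro r hr
    by_cases h : r ≤ S.R
    · exact indicator_of_mem (show r ∈ Ioc 0 S.R from ⟨ha.trans hr.1, h⟩) _
    · rw [indicator_of_notMem fun hm => h hm.2, S.ρ_vacuum r (not_le.1 h)]
  refine memLp_top_of_bound (hmeas.aestronglyMeasurable.congr ?_) (max C 0) ?_
  · filter_upwards [ae_restrict_mem measurableSet_Ioo] with r hr using heq r hr
  · filter_upwards [ae_restrict_mem measurableSet_Ioo] with r hr
    by_cases h : r ≤ S.R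
    · exact (hC r ⟨hr.1.le, h⟩).trans (le_max_left _ _)
    · rw [S.ρ_vacuum r (not_le.1 h), norm_zero]
      exact le_max_right _ _

lemma memLp_top_affine_rho {a b : ℝ} (ha : 0 < a) {A B : ℝ → ℂ} (hA : ContinuousOn A (Ioi 0))
    (hB : ContinuousOn B (Ioi 0)) :
    MemLp (fun r => A r + B r * (S.ρ r : ℂ)) ∞ (volume.restrict (Ioo a b)) :=
  (memLp_top_of_continuousOn ha hA).add
    ((S.memLp_top_rho ha).ofReal.mul' (memLp_top_of_continuousOn ha hB))

lemma exists_weight_bounds {a b : ℝ} (ha : 0 < a) (hab : a < b) (i : Fin 3) :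
    ∃ c C : ℝ, 0 < c ∧ ∀ r ∈ Icc a b,
      c ≤ (![S.j r, S.j r, r ^ 2 * S.j r] : Fin 3 → ℝ) i ∧
      (![S.j r, S.j r, r ^ 2 * S.j r] : Fin 3 → ℝ) i ≤ C := by
  have hsub : Icc a b ⊆ Ioi 0 := fun x hx => ha.trans_le hx.1
  have hc : ContinuousOn (fun r => (![S.j r, S.j r, r ^ 2 * S.j r] : Fin 3 → ℝ) i) (Icc a b) := by
    have hj := S.continuousOn_j.mono hsub
    fin_cases i
    · exact hj
    · exact hj
    · exact (continuousOn_id.pow 2).mul hj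
  have hpos : ∀ r ∈ Icc a b, 0 < (![S.j r, S.j r, r ^ 2 * S.j r] : Fin 3 → ℝ) i := by
    intro r hr
    have hj : 0 < S.j r := Real.exp_pos _
    have h0 : 0 < r := hsub hr
    fin_cases i
    · exact hj
    · exact hj
    · exact mul_pos (pow_pos h0 2) hj
  obtain ⟨x, hx, hmin⟩ := isCompact_Icc.exists_isMinOn (nonempty_Icc.2 hab.le) hc
  obtain ⟨y, hy, hmax⟩ := isCompact_Icc.exists_isMaxOn (nonempty_Icc.2 hab.le) hc
  exact ⟨_, _, hpos x hx, fun r hr => ⟨hmin hr, hmax hr⟩⟩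

lemma exists_volume_le_smul_mu {a b : ℝ} (ha : 0 < a) (hab : a < b) (i : Fin 3) :
    ∃ C : ℝ≥0∞, C ≠ ∞ ∧ volume.restrict (Ioo a b) ≤ C • S.mu a b i := by
  obtain ⟨c, _, hc, h⟩ := S.exists_weight_bounds ha hab i
  have hc0 : ENNReal.ofReal c ≠ 0 := by simpa using hc
  refine ⟨(ENNReal.ofReal c)⁻¹, ENNReal.inv_ne_top.2 hc0, ?_⟩
  have hle : ENNReal.ofReal c • volume.restrict (Ioo a b) ≤ S.mu a b i := by
    rw [← withDensity_const]
    refine withDensity_mono ?_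
    filter_upwards [ae_restrict_mem measurableSet_Ioo] with r hr
    exact ENNReal.ofReal_le_ofReal (h r (Ioo_subset_Icc_self hr)).1
  calc volume.restrict (Ioo a b)
      = (ENNReal.ofReal c)⁻¹ • ENNReal.ofReal c • volume.restrict (Ioo a b) := by
        rw [smul_smul, ENNReal.inv_mul_cancel hc0 ENNReal.ofReal_ne_top, one_smul]
    _ ≤ _ := by gcongr

lemma exists_mu_le_smul_volume {a b : ℝ} (ha : 0 < a) (hab : a < b) (i : Fin 3) :
    ∃ C : ℝ≥0∞, C ≠ ∞ ∧ S.mu a b i ≤ C • volume.restrict (Ioo a b) := by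
  obtain ⟨_, C, -, h⟩ := S.exists_weight_bounds ha hab i
  refine ⟨ENNReal.ofReal C, ENNReal.ofReal_ne_top, ?_⟩
  rw [← withDensity_const]
  refine withDensity_mono ?_
  filter_upwards [ae_restrict_mem measurableSet_Ioo] with r hr
  exact ENNReal.ofReal_le_ofReal (h r (Ioo_subset_Icc_self hr)).2

lemma ae_volume_of_ae_mu {a b : ℝ} (ha : 0 < a) (hab : a < b) (i : Fin 3) {p : ℝ → Prop}
    (h : ∀ᵐ r ∂(S.mu a b i), p r) : ∀ᵐ r ∂(volume.restrict (Ioo a b)), p r := by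
  obtain ⟨C, -, hC⟩ := S.exists_volume_le_smul_mu ha hab i
  exact (Measure.absolutelyContinuous_of_le_smul hC).ae_le h

lemma ae_mu_of_ae_volume {a b : ℝ} (ha : 0 < a) (hab : a < b) (i : Fin 3) {p : ℝ → Prop}
    (h : ∀ᵐ r ∂(volume.restrict (Ioo a b)), p r) : ∀ᵐ r ∂(S.mu a b i), p r := by
  obtain ⟨C, -, hC⟩ := S.exists_mu_le_smul_volume ha hab i
  exact (Measure.absolutelyContinuous_of_le_smul hC).ae_le h

lemma memLp_volume {a b : ℝ} (ha : 0 < a) (hab : a < b) (u : S.X a b) (i : Fin 3) :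
    MemLp (u i) 2 (volume.restrict (Ioo a b)) := by
  obtain ⟨C, hC0, hC⟩ := S.exists_volume_le_smul_mu ha hab i
  exact (Lp.memLp (u i)).of_measure_le_smul hC0 hC

lemma tendstoL2_of_tendsto {a b : ℝ} (ha : 0 < a) (hab : a < b) {u : ℕ → S.X a b} {u' : S.X a b}
    (h : Tendsto u atTop (𝓝 u')) (i : Fin 3) :
    TendstoL2 (volume.restrict (Ioo a b)) (fun n => (u n i : ℝ → ℂ)) (u' i) where
  memLp n := S.memLp_volume ha hab (u n) i
  memLp_lim := S.memLp_volume ha hab u' i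
  tendsto := by
    obtain ⟨C, hC0, hC⟩ := S.exists_volume_le_smul_mu ha hab i
    have hi : Tendsto (fun n => u n i) atTop (𝓝 (u' i)) :=
      ((PiLp.continuous_apply 2 _ i).tendsto u').comp h
    have h1 := ENNReal.Tendsto.const_mul ((Lp.tendsto_Lp_iff_tendsto_eLpNorm' _ _).1 hi)
      (a := C ^ (1 / (2 : ℝ≥0∞).toReal))
      (Or.inr (ENNReal.rpow_ne_top_of_nonneg (by norm_num) hC0))
    rw [mul_zero] at h1
    refine tendsto_of_tendsto_of_tendsto_of_le_of_le tendsto_const_nhds h1 (fun _ => zero_le) ?_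
    intro n
    refine (eLpNorm_le_of_measure_le_smul hC).trans (le_of_eq ?_)
    simp

end RotatingStar

/-! ### Weak form of the evolution equations -/

namespace RotatingStar

variable (S : RotatingStar)

/-- For `v = D u`, the derivative of `u₀ + α u₂` expressed through `u` and `v` without
derivatives of `u`: the second component of `-D u = -v`, divided by `e^{ν - λ}` and with `u₁'`
replaced by `u₂ - v₀`. -/
noncomputable def flux (l : ℕ) (m : ℤ) (u v : Fin 3 → ℝ → ℂ) (r : ℝ) : ℂ :=
  let Λ : ℝ := l * (l + 1)
  let k : ℝ := 4 * Real.pi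
  let imΛ : ℂ := Complex.I * m / (Λ : ℂ)
  let el : ℝ := Real.exp (-S.lam r)
  let E : ℝ := Real.exp (S.lam r - S.ν r)
  deriv (S.alpha l m) r * u 2 r - (E : ℂ) * v 1 r
    - ((E * (Real.exp (S.ν r) / r ^ 2 * (2 * S.M r + k * r ^ 3 * (S.p r - S.ρ r))) : ℝ) : ℂ) * u 0 r
    + imΛ * ((E * (Λ * S.ω r - 2 * el * r * deriv S.ω r
        - S.varpi r * (2 * k * r ^ 2 * (S.ρ r + S.p r) + 4 * S.M r / r - Λ)) : ℝ) : ℂ) * u 1 r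
    + imΛ * ((2 * E * S.varpi r * el * r : ℝ) : ℂ) * (u 2 r - v 0 r)
    + imΛ * ((E * (deriv S.ω r * el * r ^ 2
        + S.varpi r * (k * r ^ 3 * (S.ρ r + S.p r) - 2 * r * el)) : ℝ) : ℂ) * u 2 r

/-- For `v = D u`, the combination `(2/r) v₁ - v₂`, in which all derivatives except `u₁'` cancel,
minus its value in terms of `u` and `v`. -/
noncomputable def constraint (l : ℕ) (m : ℤ) (u v : Fin 3 → ℝ → ℂ) (r : ℝ) : ℂ :=
  let Λ : ℝ := l * (l + 1)
  let imΛ : ℂ := Complex.I * m / (Λ : ℂ)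
  ((2 / r : ℝ) : ℂ) * v 1 r - v 2 r
    - ((Real.exp (S.ν r) * (Λ - 2) / r ^ 2 : ℝ) : ℂ) * u 0 r
    + Complex.I * m * (S.ω r : ℂ) * v 0 r
    - imΛ * ((2 * (deriv S.ω r + Λ * S.ω r / r) : ℝ) : ℂ) * u 1 r
    + Complex.I * m * (S.ω r : ℂ) * u 2 r

/-- The equations `v = D u` in a form that makes sense for square integrable `u` and `v`. -/
structure WeakEvolution (l : ℕ) (m : ℤ) (a b : ℝ) (u v : Fin 3 → ℝ → ℂ) : Prop where
  primitive_one : IsPrimitive a b (u 1) (fun r => u 2 r - v 0 r)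
  primitive_flux : IsPrimitive a b (fun r => u 0 r + S.alpha l m r * u 2 r) (S.flux l m u v)
  constraint_ae : S.constraint l m u v =ᵐ[volume.restrict (Ioo a b)] 0

variable {S} {l : ℕ} {m : ℤ} {a b : ℝ}

lemma tendstoL2_flux (ha : 0 < a) {u v : ℕ → Fin 3 → ℝ → ℂ} {u' v' : Fin 3 → ℝ → ℂ}
    (hu : ∀ i, TendstoL2 (volume.restrict (Ioo a b)) (fun n => u n i) (u' i))
    (hv : ∀ i, TendstoL2 (volume.restrict (Ioo a b)) (fun n => v n i) (v' i)) :
    TendstoL2 (volume.restrict (Ioo a b)) (fun n => S.flux l m (u n) (v n))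
      (S.flux l m u' v') := by
  have hM := S.M_continuousOn
  have hp := S.p_continuousOn
  have hl := S.continuousOn_lam
  have hn := S.continuousOn_nu
  have ho := S.continuousOn_omega
  have hd := S.continuousOn_deriv_omega
  have hw := S.continuousOn_varpi
  have h0 : ∀ r ∈ Ioi (0 : ℝ), r ≠ 0 := fun r hr => ne_of_gt hr
  have h0' : ∀ r ∈ Ioi (0 : ℝ), r ^ 2 ≠ 0 := fun r hr => pow_ne_zero 2 (ne_of_gt hr)
  have hα : ContinuousOn (deriv (S.alpha l m)) (Ioi 0) :=
    (S.contDiffOn_alpha l m).continuousOn_deriv_of_isOpen isOpen_Ioi le_rfl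
  have key : ∀ {A B : ℝ → ℝ} (c : ℂ) {d : ℝ → ℂ}, ContinuousOn A (Ioi 0) →
      ContinuousOn B (Ioi 0) → (∀ r, d r = c * ((A r + B r * S.ρ r : ℝ) : ℂ)) →
      MemLp d ∞ (volume.restrict (Ioo a b)) := by
    intro A B c d hA hB hd
    have := (S.memLp_top_affine_rho (b := b) ha (.complex_ofReal hA)
      (.complex_ofReal hB)).const_mul c
    convert this using 2 with r
    rw [hd]; push_cast; ring
  refine ((((((hu 2).mul_left ?_).sub ((hv 1).mul_left ?_)).sub ((hu 0).mul_left ?_)).add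
    ((hu 1).mul_left ?_)).add (((hu 2).sub (hv 0)).mul_left ?_)).add ((hu 2).mul_left ?_)
  · exact memLp_top_of_continuousOn ha hα
  · exact memLp_top_of_continuousOn ha (.complex_ofReal (by fun_prop))
  · refine key (A := fun r => Real.exp (S.lam r - S.ν r) * (Real.exp (S.ν r) / r ^ 2
        * (2 * S.M r + 4 * Real.pi * r ^ 3 * S.p r)))
      (B := fun r => -(Real.exp (S.lam r - S.ν r) * (Real.exp (S.ν r) / r ^ 2
        * (4 * Real.pi * r ^ 3)))) 1
      (by fun_prop (disch := assumption)) (by fun_prop (disch := assumption)) fun r => ?_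
    rw [one_mul]; congr 1; ring
  · refine key (A := fun r => Real.exp (S.lam r - S.ν r) * ((l * (l + 1) : ℝ) * S.ω r
        - 2 * Real.exp (-S.lam r) * r * deriv S.ω r
        - S.varpi r * (2 * (4 * Real.pi) * r ^ 2 * S.p r + 4 * S.M r / r - (l * (l + 1) : ℝ))))
      (B := fun r => -(Real.exp (S.lam r - S.ν r) * S.varpi r * (2 * (4 * Real.pi) * r ^ 2)))
      (Complex.I * m / ((l * (l + 1) : ℝ) : ℂ))
      (by fun_prop (disch := assumption)) (by fun_prop (disch := assumption)) fun r => ?_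
    congr 2; ring
  · refine memLp_top_of_continuousOn ha (continuousOn_const.mul (.complex_ofReal ?_))
    fun_prop
  · refine key (A := fun r => Real.exp (S.lam r - S.ν r) *
        (deriv S.ω r * Real.exp (-S.lam r) * r ^ 2
        + S.varpi r * (4 * Real.pi * r ^ 3 * S.p r - 2 * r * Real.exp (-S.lam r))))
      (B := fun r => Real.exp (S.lam r - S.ν r) * S.varpi r * (4 * Real.pi * r ^ 3))
      (Complex.I * m / ((l * (l + 1) : ℝ) : ℂ))
      (by fun_prop) (by fun_prop) fun r => ?_
    congr 2; ring

lemma memLp_flux (ha : 0 < a) {u v : Fin 3 → ℝ → ℂ}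
    (hu : ∀ i, MemLp (u i) 2 (volume.restrict (Ioo a b)))
    (hv : ∀ i, MemLp (v i) 2 (volume.restrict (Ioo a b))) :
    MemLp (S.flux l m u v) 2 (volume.restrict (Ioo a b)) :=
  (tendstoL2_flux (u := fun _ => u) (v := fun _ => v) ha (fun i => .const (hu i))
    fun i => .const (hv i)).memLp_lim

lemma tendstoL2_constraint (ha : 0 < a) {u v : ℕ → Fin 3 → ℝ → ℂ} {u' v' : Fin 3 → ℝ → ℂ}
    (hu : ∀ i, TendstoL2 (volume.restrict (Ioo a b)) (fun n => u n i) (u' i))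
    (hv : ∀ i, TendstoL2 (volume.restrict (Ioo a b)) (fun n => v n i) (v' i)) :
    TendstoL2 (volume.restrict (Ioo a b)) (fun n => S.constraint l m (u n) (v n))
      (S.constraint l m u' v') := by
  have hn := S.continuousOn_nu
  have ho := S.continuousOn_omega
  have hd := S.continuousOn_deriv_omega
  have h0 : ∀ r ∈ Ioi (0 : ℝ), r ≠ 0 := fun r hr => ne_of_gt hr
  have h0' : ∀ r ∈ Ioi (0 : ℝ), r ^ 2 ≠ 0 := fun r hr => pow_ne_zero 2 (ne_of_gt hr)
  have hbdd : ∀ {f : ℝ → ℝ} (c : ℂ), ContinuousOn f (Ioi 0) →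
      MemLp (fun r => c * (f r : ℂ)) ∞ (volume.restrict (Ioo a b)) := fun c hf =>
    memLp_top_of_continuousOn ha
      (continuousOn_const.mul (.complex_ofReal hf))
  have hbdd1 : ∀ {f : ℝ → ℝ}, ContinuousOn f (Ioi 0) →
      MemLp (fun r => (f r : ℂ)) ∞ (volume.restrict (Ioo a b)) := fun hf =>
    memLp_top_of_continuousOn ha (.complex_ofReal hf)
  refine ((((((hv 1).mul_left ?_).sub (hv 2)).sub ((hu 0).mul_left ?_)).add
    ((hv 0).mul_left ?_)).sub ((hu 1).mul_left ?_)).add ((hu 2).mul_left ?_)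
  · exact hbdd1 (by fun_prop (disch := assumption))
  · exact hbdd1 (by fun_prop (disch := assumption))
  · exact hbdd _ ho
  · exact hbdd _ (by fun_prop (disch := assumption))
  · exact hbdd _ ho

/-- For differentiable `h` the right-hand side is the derivative of `h₁ + α Z`: dividing by
`e^{ν - λ}` turns the coefficients of `h₁'` and `Z'` into `1` and `α`. -/
lemma flux_evolD (h : Fin 3 → ℝ → ℂ) {r : ℝ} :
    S.flux l m h (S.evolD l m h) r =
      deriv (h 0) r + (deriv (S.alpha l m) r * h 2 r + S.alpha l m r * deriv (h 2) r) := by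
  have e1 : Real.exp (S.lam r - S.ν r) = Real.exp (S.lam r) * Real.exp (-S.ν r) := by
    rw [← Real.exp_add]; ring_nf
  have e2 : Real.exp (S.ν r - S.lam r) = Real.exp (S.ν r) * Real.exp (-S.lam r) := by
    rw [← Real.exp_add]; ring_nf
  have e3 : (Real.exp (S.lam r) : ℂ) * (Real.exp (-S.lam r) : ℂ) = 1 := by
    rw [← Complex.ofReal_mul, ← Real.exp_add]; simp
  have e4 : (Real.exp (S.ν r) : ℂ) * (Real.exp (-S.ν r) : ℂ) = 1 := by
    rw [← Complex.ofReal_mul, ← Real.exp_add]; simp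
  simp only [flux, evolD, alpha, e1, e2, Matrix.cons_val_zero, Matrix.cons_val_one,
    Complex.ofReal_mul, Complex.ofReal_add, Complex.ofReal_sub, Complex.ofReal_div,
    Complex.ofReal_pow, Complex.ofReal_ofNat]
  generalize (Complex.I * m / _ : ℂ) = c
  linear_combination (
    (Real.exp (S.ν r) : ℂ) * (Real.exp (-S.ν r) : ℂ) * deriv (h 0) r
      + c * (S.varpi r : ℂ) * (r : ℂ) ^ 2 * (Real.exp (-S.ν r) : ℂ) * deriv (h 2) r) * e3
      + deriv (h 0) r * e4

lemma constraint_evolD (h : Fin 3 → ℝ → ℂ) {r : ℝ} (hl : 2 ≤ l) (hr : 0 < r) :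
    S.constraint l m h (S.evolD l m h) r = 0 := by
  have hr' : (r : ℂ) ≠ 0 := by exact_mod_cast hr.ne'
  have hΛ : (l : ℂ) * ((l : ℂ) + 1) ≠ 0 := by
    have : l ≠ 0 := by omega
    exact mul_ne_zero (by exact_mod_cast this) (by exact_mod_cast Nat.succ_ne_zero l)
  simp only [constraint, evolD, Matrix.cons_val_zero, Matrix.cons_val_one,
    Matrix.cons_val, Complex.ofReal_mul, Complex.ofReal_add, Complex.ofReal_sub, Complex.ofReal_div,
    Complex.ofReal_pow, Complex.ofReal_ofNat, Complex.ofReal_natCast, Complex.ofReal_one]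
  generalize (Real.exp (S.ν r - S.lam r) : ℂ) = x1
  generalize (Real.exp (S.ν r) : ℂ) = x2
  generalize (Real.exp (-S.lam r) : ℂ) = x3
  have hl1 : (l : ℂ) + 1 ≠ 0 := right_ne_zero_of_mul hΛ
  have hl0 : (l : ℂ) ≠ 0 := left_ne_zero_of_mul hΛ
  field_simp
  ring

lemma WeakEvolution.congr {u v u' v' : Fin 3 → ℝ → ℂ} (h : S.WeakEvolution l m a b u v)
    (hu : ∀ i, u i =ᵐ[volume.restrict (Ioo a b)] u' i)
    (hv : ∀ i, v i =ᵐ[volume.restrict (Ioo a b)] v' i) : S.WeakEvolution l m a b u' v' where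
  primitive_one := h.primitive_one.congr (hu 1) ((hu 2).sub (hv 0))
  primitive_flux := by
    refine h.primitive_flux.congr ?_ ?_
    · filter_upwards [hu 0, hu 2] with r h0 h2
      rw [h0, h2]
    · filter_upwards [ae_all_iff.2 hu, ae_all_iff.2 hv] with r h1 h2
      simp only [flux, h1, h2]
  constraint_ae := by
    filter_upwards [h.constraint_ae, ae_all_iff.2 hu, ae_all_iff.2 hv] with r h0 h1 h2
    rw [← h0]
    simp only [constraint, h1, h2]

lemma WeakEvolution.of_isRegular (hl : 2 ≤ l) (ha : 0 < a) (hab : a < b) {h : Fin 3 → ℝ → ℂ}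
    (hreg : IsRegular a b h) (hh : ∀ i, MemLp (h i) 2 (volume.restrict (Ioo a b)))
    (hD : ∀ i, MemLp (S.evolD l m h i) 2 (volume.restrict (Ioo a b))) :
    S.WeakEvolution l m a b h (S.evolD l m h) where
  primitive_one := by
    refine IsPrimitive.of_hasDerivAt hab (fun x hx => ?_)
      (((hh 2).sub (hD 0)).integrable (by norm_num))
    have := ((hreg.2.1.contDiffAt (isOpen_Ioo.mem_nhds hx)).differentiableAt two_ne_zero).hasDerivAt
    have heq : h 2 x - S.evolD l m h 0 x = deriv (h 1) x := by simp [evolD]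
    rwa [heq]
  primitive_flux := by
    refine IsPrimitive.of_hasDerivAt hab (fun x hx => ?_)
      ((memLp_flux ha hh hD).integrable (by norm_num))
    have h0 := ((hreg.1.contDiffAt (isOpen_Ioo.mem_nhds hx)).differentiableAt
      one_ne_zero).hasDerivAt
    have h2 := ((hreg.2.2.contDiffAt (isOpen_Ioo.mem_nhds hx)).differentiableAt
      one_ne_zero).hasDerivAt
    rw [flux_evolD]
    exact h0.add ((S.hasDerivAt_alpha l m (ha.trans hx.1)).mul h2)
  constraint_ae := by
    filter_upwards [ae_restrict_mem measurableSet_Ioo] with r hr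
    exact constraint_evolD h hl (ha.trans hr.1)

lemma WeakEvolution.of_tendstoL2 (ha : 0 < a) (hab : a < b) {u v : ℕ → Fin 3 → ℝ → ℂ}
    {u' v' : Fin 3 → ℝ → ℂ} (h : ∀ n, S.WeakEvolution l m a b (u n) (v n))
    (hu : ∀ i, TendstoL2 (volume.restrict (Ioo a b)) (fun n => u n i) (u' i))
    (hv : ∀ i, TendstoL2 (volume.restrict (Ioo a b)) (fun n => v n i) (v' i)) :
    S.WeakEvolution l m a b u' v' where
  primitive_one :=
    IsPrimitive.of_tendstoL2 hab (fun n => (h n).primitive_one) (hu 1) ((hu 2).sub (hv 0))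
  primitive_flux := by
    refine IsPrimitive.of_tendstoL2 hab (fun n => (h n).primitive_flux)
      ((hu 0).add ((hu 2).mul_left ?_)) (tendstoL2_flux ha hu hv)
    exact memLp_top_of_continuousOn ha (S.contDiffOn_alpha l m).continuousOn
  constraint_ae :=
    (tendstoL2_constraint ha hu hv).ae_eq_zero_of_forall fun n => (h n).constraint_ae

/-- The weak evolution equations hold on the closure of the graph, whatever the boundary
conditions. -/
lemma IsEvolutionOperator.weakEvolution_of_mem_closure (hl : 2 ≤ l) (ha : 0 < a) (hab : a < b)
    {A : S.X a b →ₗ.[ℂ] S.X a b} (hA : S.IsEvolutionOperator l m a b A) {u v : S.X a b}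
    (huv : (u, v) ∈ A.graph.topologicalClosure) :
    S.WeakEvolution l m a b (fun i => u i) (fun i => v i) := by
  obtain ⟨w, hw, hlim⟩ := mem_closure_iff_seq_limit.1 huv
  refine WeakEvolution.of_tendstoL2 ha hab (u := fun n i => (w n).1 i) (v := fun n i => (w n).2 i)
    (fun n => ?_)
    (S.tendstoL2_of_tendsto ha hab ((continuous_fst.tendsto _).comp hlim))
    (S.tendstoL2_of_tendsto ha hab ((continuous_snd.tendsto _).comp hlim))
  obtain ⟨h, hreg, h1, h2⟩ := hA.classical (w n).1 (w n).2 (hw n)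
  have h1' : ∀ i, ((w n).1 i : ℝ → ℂ) =ᵐ[volume.restrict (Ioo a b)] h i :=
    fun i => S.ae_volume_of_ae_mu ha hab i (h1 i)
  have h2' : ∀ i, ((w n).2 i : ℝ → ℂ) =ᵐ[volume.restrict (Ioo a b)] S.evolD l m h i :=
    fun i => S.ae_volume_of_ae_mu ha hab i (h2 i)
  refine (WeakEvolution.of_isRegular hl ha hab hreg (fun i => ?_) (fun i => ?_)).congr
    (fun i => (h1' i).symm) (fun i => (h2' i).symm)
  · exact (memLp_congr_ae (h1' i)).1 (S.memLp_volume ha hab (w n).1 i)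
  · exact (memLp_congr_ae (h2' i)).1 (S.memLp_volume ha hab (w n).2 i)

end RotatingStar

/-! ### Closability and the spectrum -/

namespace RotatingStar

variable {S : RotatingStar} {l : ℕ} {m : ℤ} {a b : ℝ}

lemma eq_zero_of_ae_volume (ha : 0 < a) (hab : a < b) {v : S.X a b}
    (h : ∀ i, (v i : ℝ → ℂ) =ᵐ[volume.restrict (Ioo a b)] 0) : v = 0 := by
  ext i : 1
  exact (Lp.eq_zero_iff_ae_eq_zero).2 (S.ae_mu_of_ae_volume ha hab i (h i))

/-- The weak equations determine `v` from `u`: if `u` vanishes, then the two primitives show that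
`v₀` and then `v₁` vanish, and the constraint gives `v₂ = 0`. -/
lemma WeakEvolution.eq_zero (ha : 0 < a) (hab : a < b) {v : S.X a b}
    (h : S.WeakEvolution l m a b (fun i => ((0 : S.X a b) i : ℝ → ℂ)) (fun i => v i)) :
    v = 0 := by
  have h0 : ∀ i, ((0 : S.X a b) i : ℝ → ℂ) =ᵐ[volume.restrict (Ioo a b)] fun _ => 0 :=
    fun i => S.ae_volume_of_ae_mu ha hab i (Lp.coeFn_zero ℂ 2 _)
  have hv := fun i => S.memLp_volume ha hab v i
  have h' := h.congr h0 (fun i => EventuallyEq.rfl)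
  have hv0 : (v 0 : ℝ → ℂ) =ᵐ[volume.restrict (Ioo a b)] 0 := by
    have := h'.primitive_one.ae_eq_zero hab EventuallyEq.rfl
      (((memLp_const 0).sub (hv 0)).integrable (by norm_num))
    filter_upwards [this] with r hr
    simpa using hr
  have hv1 : (v 1 : ℝ → ℂ) =ᵐ[volume.restrict (Ioo a b)] 0 := by
    have := h'.primitive_flux.ae_eq_zero hab (Eventually.of_forall fun r => by simp)
      ((memLp_flux ha (fun _ => memLp_const 0) hv).integrable (by norm_num))
    filter_upwards [this, hv0] with r hr hr0
    simpa [flux, hr0] using hr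
  refine eq_zero_of_ae_volume ha hab fun i => ?_
  fin_cases i
  · exact hv0
  · exact hv1
  · filter_upwards [h'.constraint_ae, hv0, hv1] with r hr hr0 hr1
    simpa [constraint, hr0, hr1] using hr

theorem IsEvolutionOperator.isClosable (hl : 2 ≤ l) (ha : 0 < a) (hab : a < b)
    {A : S.X a b →ₗ.[ℂ] S.X a b} (hA : S.IsEvolutionOperator l m a b A) : A.IsClosable := by
  refine ⟨A.graph.topologicalClosure.toLinearPMap, (Submodule.toLinearPMap_graph_eq _ ?_).symm⟩
  rintro ⟨u, v⟩ huv (rfl : u = 0)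
  exact (hA.weakEvolution_of_mem_closure hl ha hab huv).eq_zero ha hab

/-- The coefficient of `Z` left after `h₁` has been eliminated from the constraint of
`D h - σ h` in favour of `h₁ + α Z`. -/
noncomputable def symbol (S : RotatingStar) (l : ℕ) (m : ℤ) (σ : ℂ) (r : ℝ) : ℂ :=
  Complex.I * m * ((S.Ω - 2 / (l * (l + 1)) * S.varpi r : ℝ) : ℂ) - σ * (S.kojimaDenom l m r : ℂ)

lemma symbol_kojimaValue {r : ℝ} (h : S.kojimaDenom l m r ≠ 0) :
    S.symbol l m (S.kojimaValue l m r) r = 0 := by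
  have : (S.kojimaDenom l m r : ℂ) ≠ 0 := by exact_mod_cast h
  rw [symbol, kojimaValue, div_mul_cancel₀ _ this, sub_self]

lemma differentiableAt_symbol (σ : ℂ) {r : ℝ} (hr : 0 < r) :
    DifferentiableAt ℝ (S.symbol l m σ) r := by
  have hω : DifferentiableAt ℝ S.ω r :=
    (S.ω_contDiffOn.contDiffAt (Ioi_mem_nhds hr)).differentiableAt one_ne_zero
  have hϖ : DifferentiableAt ℝ S.varpi r := (differentiableAt_const _).sub hω
  have hν : DifferentiableAt ℝ S.ν r := (S.ν_deriv r hr).differentiableAt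
  have h1 : DifferentiableAt ℝ (fun r => S.Ω - 2 / ((l : ℝ) * (l + 1)) * S.varpi r) r := by
    fun_prop
  have h2 : DifferentiableAt ℝ (fun r => S.kojimaDenom l m r) r := by
    unfold kojimaDenom
    fun_prop
  have hcast : ∀ {f : ℝ → ℝ}, DifferentiableAt ℝ f r →
      DifferentiableAt ℝ (fun r => (f r : ℂ)) r :=
    fun hf => Complex.ofRealCLM.differentiableAt.comp r hf
  exact ((hcast h1).const_mul _).sub ((hcast h2).const_mul _)

/-- The factor multiplying `-h₁` in the constraint of `D h - σ h`. -/
noncomputable def h₁Coeff (S : RotatingStar) (l : ℕ) (m : ℤ) (σ : ℂ) (r : ℝ) : ℂ :=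
  ((Real.exp (S.ν r) * ((l * (l + 1) : ℝ) - 2) / r ^ 2 : ℝ) : ℂ) - Complex.I * m * σ * (S.ω r : ℂ)

/-- The factor multiplying `h₀` in the constraint of `D h - σ h`. -/
noncomputable def h₀Coeff (S : RotatingStar) (l : ℕ) (m : ℤ) (σ : ℂ) (r : ℝ) : ℂ :=
  σ * ((2 / r : ℝ) : ℂ) - Complex.I * m / ((l * (l + 1) : ℝ) : ℂ) *
    ((2 * (deriv S.ω r + (l * (l + 1) : ℝ) * S.ω r / r) : ℝ) : ℂ)

lemma symbol_eq (hl : 2 ≤ l) (σ : ℂ) {r : ℝ} (hr : 0 < r) :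
    S.symbol l m σ r =
      Complex.I * m * (S.ω r : ℂ) - σ + S.alpha l m r * S.h₁Coeff l m σ r := by
  have hr' : (r : ℂ) ≠ 0 := by exact_mod_cast hr.ne'
  have hl0 : (l : ℂ) ≠ 0 := by
    have : l ≠ 0 := by omega
    exact_mod_cast this
  have hl1 : (l : ℂ) + 1 ≠ 0 := by exact_mod_cast Nat.succ_ne_zero l
  have e4 : (Real.exp (S.ν r) : ℂ) * (Real.exp (-S.ν r) : ℂ) = 1 := by
    rw [← Complex.ofReal_mul, ← Real.exp_add]; simp
  simp only [symbol, kojimaDenom, alpha, h₁Coeff, varpi, Complex.ofReal_mul, Complex.ofReal_add,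
    Complex.ofReal_sub, Complex.ofReal_div, Complex.ofReal_pow, Complex.ofReal_ofNat,
    Complex.ofReal_natCast, Complex.ofReal_one, Complex.ofReal_intCast]
  generalize (Real.exp (S.ν r) : ℂ) = x at e4 ⊢
  generalize (Real.exp (-S.ν r) : ℂ) = y at e4 ⊢
  field_simp
  linear_combination (-(Complex.I * m * (l * (l + 1) - 2) * ((S.Ω : ℂ) - S.ω r))) * e4
    + (σ * m ^ 2 * S.ω r * ((S.Ω : ℂ) - S.ω r) * r ^ 2 * y) * Complex.I_sq

lemma constraint_resolvent (hl : 2 ≤ l) (σ : ℂ) (u : Fin 3 → ℝ → ℂ) (f : ℝ → ℂ) {r : ℝ}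
    (hr : 0 < r) :
    S.constraint l m u
        ![fun r => σ * u 0 r, fun r => σ * u 1 r, fun r => σ * u 2 r + f r] r =
      S.symbol l m σ r * u 2 r - S.h₁Coeff l m σ r * (u 0 r + S.alpha l m r * u 2 r)
        + S.h₀Coeff l m σ r * u 1 r - f r := by
  rw [symbol_eq hl σ hr]
  simp only [constraint, h₁Coeff, h₀Coeff, Matrix.cons_val_zero, Matrix.cons_val_one,
    Matrix.cons_val]
  ring

/-- The reduced coefficients are bounded and `h₀`, `h₁ + α Z` are primitives, hence bounded: a
right-hand side `(0, 0, f)` of the resolvent equation is bounded by the symbol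
times `Z`, up to a constant. -/
lemma WeakEvolution.exists_norm_le (hl : 2 ≤ l) (ha : 0 < a) {σ : ℂ}
    {u : Fin 3 → ℝ → ℂ} {f : ℝ → ℂ} (hu : ∀ i, MemLp (u i) 2 (volume.restrict (Ioo a b)))
    (hf : MemLp f 2 (volume.restrict (Ioo a b)))
    (h : S.WeakEvolution l m a b u
      ![fun r => σ * u 0 r, fun r => σ * u 1 r, fun r => σ * u 2 r + f r]) :
    ∃ C, ∀ᵐ r ∂(volume.restrict (Ioo a b)), ‖f r‖ ≤ ‖S.symbol l m σ r‖ * ‖u 2 r‖ + C := by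
  set v : Fin 3 → ℝ → ℂ :=
    ![fun r => σ * u 0 r, fun r => σ * u 1 r, fun r => σ * u 2 r + f r]
  have hvL : ∀ i, MemLp (v i) 2 (volume.restrict (Ioo a b)) := by
    intro i
    fin_cases i
    · exact (hu 0).const_mul σ
    · exact (hu 1).const_mul σ
    · exact ((hu 2).const_mul σ).add hf
  obtain ⟨C₁, hC₁⟩ := h.primitive_one.exists_bound (((hu 2).sub (hvL 0)).integrable (by norm_num))
  obtain ⟨C₂, hC₂⟩ := h.primitive_flux.exists_bound
    ((memLp_flux ha hu hvL).integrable (by norm_num))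
  have hsub : Icc a b ⊆ Ioi 0 := fun x hx => ha.trans_le hx.1
  have hn := S.continuousOn_nu
  have ho := S.continuousOn_omega
  have hd := S.continuousOn_deriv_omega
  have h0 : ∀ r ∈ Ioi (0 : ℝ), r ≠ 0 := fun r hr => ne_of_gt hr
  have h0' : ∀ r ∈ Ioi (0 : ℝ), r ^ 2 ≠ 0 := fun r hr => pow_ne_zero 2 (ne_of_gt hr)
  obtain ⟨K₁, hK₁⟩ := isCompact_Icc.exists_bound_of_continuousOn
    (f := S.h₁Coeff l m σ) (s := Icc a b)
    (((ContinuousOn.complex_ofReal (by fun_prop (disch := assumption))).sub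
      (continuousOn_const.mul (ContinuousOn.complex_ofReal ho))).mono hsub)
  obtain ⟨K₀, hK₀⟩ := isCompact_Icc.exists_bound_of_continuousOn
    (f := S.h₀Coeff l m σ) (s := Icc a b)
    (((continuousOn_const.mul (ContinuousOn.complex_ofReal (by fun_prop (disch := assumption)))).sub
      (continuousOn_const.mul (ContinuousOn.complex_ofReal
        (by fun_prop (disch := assumption))))).mono hsub)
  refine ⟨K₁ * C₂ + K₀ * C₁, ?_⟩
  filter_upwards [h.constraint_ae, hC₁, hC₂, ae_restrict_mem measurableSet_Ioo] with r h1 h2 h3 hr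
  rw [constraint_resolvent hl σ u f (ha.trans hr.1), Pi.zero_apply, sub_eq_zero] at h1
  have hr' := Ioo_subset_Icc_self hr
  rw [← h1]
  calc _ ≤ ‖S.symbol l m σ r‖ * ‖u 2 r‖
        + ‖S.h₁Coeff l m σ r‖ * ‖u 0 r + S.alpha l m r * u 2 r‖
        + ‖S.h₀Coeff l m σ r‖ * ‖u 1 r‖ := by
        simp only [← norm_mul]
        exact (norm_add_le _ _).trans (add_le_add_left (norm_sub_le _ _) _)
    _ ≤ ‖S.symbol l m σ r‖ * ‖u 2 r‖ + K₁ * C₂ + K₀ * C₁ := by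
        have hK₁' := (norm_nonneg _).trans (hK₁ r hr')
        have hK₀' := (norm_nonneg _).trans (hK₀ r hr')
        gcongr
        · exact hK₁ r hr'
        · exact hK₀ r hr'
    _ = _ := by ring

/-- At a zero `r₀` of the symbol the right-hand side `(0, 0, |r - r₀|^(-1/4))` is not attained by
`A.closure - σ`. -/
theorem IsEvolutionOperator.mem_opSpectrum_of_symbol_eq_zero (hl : 2 ≤ l) (ha : 0 < a)
    (hab : a < b) {A : S.X a b →ₗ.[ℂ] S.X a b} (hA : S.IsEvolutionOperator l m a b A) {σ : ℂ}
    {r₀ : ℝ} (hr₀ : r₀ ∈ Icc a b) (hσ : S.symbol l m σ r₀ = 0) :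
    σ ∈ opSpectrum A.closure := by
  intro hbij
  let f : ℝ → ℂ := fun x => ((|x - r₀| ^ (-(1 / 4) : ℝ) : ℝ) : ℂ)
  have hf : MemLp f 2 (volume.restrict (Ioo a b)) := memLp_two_abs_sub_rpow a b r₀
  let F : Fin 3 → ℝ → ℂ := ![fun _ => 0, fun _ => 0, f]
  have hF : ∀ i, MemLp (F i) 2 (S.mu a b i) := by
    intro i
    obtain ⟨C, hC, hle⟩ := S.exists_mu_le_smul_volume ha hab i
    refine MemLp.of_measure_le_smul hC hle ?_
    fin_cases i
    · exact memLp_const 0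
    · exact memLp_const 0
    · exact hf
  obtain ⟨x, hx⟩ := hbij.2 (WithLp.toLp 2 fun i => (hF i).toLp (F i))
  dsimp only at hx
  rw [sub_eq_iff_eq_add] at hx
  have hgraph : ((x : S.X a b), A.closure x) ∈ A.graph.topologicalClosure := by
    rw [(hA.isClosable hl ha hab).graph_closure_eq_closure_graph]
    exact A.closure.mem_graph x
  have hweak := hA.weakEvolution_of_mem_closure hl ha hab hgraph
  have hv : ∀ i, (A.closure x i : ℝ → ℂ) =ᵐ[volume.restrict (Ioo a b)]
      fun r => σ * (x : S.X a b) i r + F i r := by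
    intro i
    refine S.ae_volume_of_ae_mu ha hab i ?_
    have hi : A.closure x i = (hF i).toLp (F i) + σ • (x : S.X a b) i := by rw [hx]; rfl
    rw [hi]
    filter_upwards [Lp.coeFn_add ((hF i).toLp (F i)) (σ • (x : S.X a b) i), (hF i).coeFn_toLp,
      Lp.coeFn_smul σ ((x : S.X a b) i)] with r h1 h2 h3
    rw [h1, Pi.add_apply, h2, h3, Pi.smul_apply, smul_eq_mul, add_comm]
  have hu := fun i => S.memLp_volume ha hab (x : S.X a b) i
  obtain ⟨C, hC⟩ := WeakEvolution.exists_norm_le (σ := σ) hl ha hu hf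
    (hweak.congr (fun i => EventuallyEq.rfl) (fun i => by
      refine (hv i).trans (Eventually.of_forall fun r => ?_)
      fin_cases i <;> simp [F]))
  refine not_ae_abs_sub_rpow_le hab hr₀ (g := S.symbol l m σ) ?_
    ((hu 2).integrable (by norm_num)) C ?_
  · simpa [hσ] using (differentiableAt_symbol (l := l) (m := m) (S := S) σ
      (ha.trans_le hr₀.1)).isBigO_sub
  · filter_upwards [hC] with r hr
    rwa [Complex.norm_real, Real.norm_of_nonneg (by positivity)] at hr

end RotatingStar

theorem mainTheorem3 (S : RotatingStar) (l : ℕ) (hl : 2 ≤ l) (m : ℤ)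
    (a b : ℝ) (ha : 0 < a) (hab : a < b)
    (A : S.X a b →ₗ.[ℂ] S.X a b) (hA : S.IsEvolutionOperator l m a b A) :
    A.IsClosable ∧
      ∀ r ∈ Set.Icc a b, S.kojimaDenom l m r ≠ 0 →
        S.kojimaValue l m r ∈ opSpectrum A.closure :=
  ⟨hA.isClosable hl ha hab, fun _ hr hden =>
    hA.mem_opSpectrum_of_symbol_eq_zero hl ha hab hr (RotatingStar.symbol_kojimaValue hden)⟩
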